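/- Let $2\le m\le n\le p$ be integers. The $m\times n\times p$ chessboard has a bi-sited closed knight tour if and only if all of the following conditions hold: (a) at least one of $m,n,p$ is even; (b) $n\ge 3$; (c) $p\ge 4$. Definitions. The board is $B=\{1,\dots,m\}\times\{1,\dots,n\}\times\{1,\dots,p\}$, with $N=mnp$ squares. A knight move is a vector of $\mathbb Z^3$ with one coordinate equal to $0$, one equal to $\pm1$ and one equal to $\pm2$. A closed knight tour is a sequence $(a^i)_{i\in\mathbb Z/N}$ of pairwise distinct squares of $B$ such that $a^{i+1}-a^i$ is a knight move for every $i\in\mathbb Z/N$. For a knight move $c$, write $c=c_1+c_2$, where $c_1$ (resp. $c_2$) is obtained from $c$ by keeping only the coordinate equal to $\pm1$ (resp. $\pm2$), and put $\tilde c=-c_1+c_2$; let $e_1,e_2,e_3$ be the canonical basis. Two edges $(a^r,a^{r+1})$ and $(a^s,a^{s+1})$ of the tour form a site if, with $c=a^{r+1}-a^r$, one of the following holds: - $a^{s+1}=a^s+\tilde c$ and $a^s-a^r=c_1$ (well-oriented cross-pattern); - $a^s=a^{s+1}+\tilde c$ and $a^{s+1}-a^r=c_1$ (non-well-oriented cross-pattern);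 - $a^s=a^{s+1}+c$ and $a^s-a^{r+1}=a^{s+1}-a^r\in\{\pm2e_1,\pm2e_2,\pm2e_3\}$ (well-oriented parallel-pattern); - $a^{s+1}=a^s+c$ and $a^s-a^r=a^{s+1}-a^{r+1}\in\{\pm2e_1,\pm2e_2,\pm2e_3\}$ (non-well-oriented parallel-pattern). The tour is bi-sited if it contains two sites with disjoint supports, that is, such that the four edges involved have pairwise disjoint sets of endpoints. -/

import Mathlib

/-- The chessboard `⟦1, n 0⟧ × ⋯ × ⟦1, n (k-1)⟧` inside `ℤᵏ`. -/
noncomputable def board {k : ℕ} (n : Fin k → ℕ) : Finset (Fin k → ℤ) :=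
  Fintype.piFinset fun i => Finset.Icc (1 : ℤ) (n i)

/-- The knight moves in `ℤᵏ`: one coordinate is `±1`, one coordinate is `±2`, and all
the others vanish. -/
def knightMoves (k : ℕ) : Set (Fin k → ℤ) :=
  {c | (Finset.univ.filter fun i => c i = 0).card + 2 = k ∧
    (Finset.univ.filter fun i => c i = 1 ∨ c i = -1).card = 1 ∧
    (Finset.univ.filter fun i => c i = 2 ∨ c i = -2).card = 1}

theorem knightMoves_neg {k : ℕ} {c : Fin k → ℤ} (hc : c ∈ knightMoves k) :
    -c ∈ knightMoves k := by
  obtain ⟨h0, h1, h2⟩ := hc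
  refine ⟨?_, ?_, ?_⟩
  · simpa using h0
  · rw [← h1]
    congr 1
    ext i
    simp only [Finset.mem_filter, Finset.mem_univ, true_and, Pi.neg_apply]
    omega
  · rw [← h2]
    congr 1
    ext i
    simp only [Finset.mem_filter, Finset.mem_univ, true_and, Pi.neg_apply]
    omega

theorem zero_notMem_knightMoves {k : ℕ} : (0 : Fin k → ℤ) ∉ knightMoves k := by
  rintro ⟨-, h1, -⟩
  simp at h1

/-- The graph whose vertices are the squares of the board and whose edges are the knight
moves between them. -/
def knightGraph {k : ℕ} (n : Fin k → ℕ) : SimpleGraph (board n) where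
  Adj a b := (a : Fin k → ℤ) - b ∈ knightMoves k
  symm := ⟨fun a b h => by
    have h' := knightMoves_neg h
    rwa [neg_sub] at h'⟩
  loopless := ⟨fun a h => zero_notMem_knightMoves (k := k) (by simpa using h)⟩

/-- A closed knight tour: a Hamiltonian cycle of the knight graph, given as a cyclic sequence
of pairwise distinct squares, as many as the board has, consecutive squares being linked by a
knight move (the indices are cyclic, so the last square is linked to the first one). -/
structure IsClosedTour {k : ℕ} (n : Fin k → ℕ) {N : ℕ} (a : ZMod N → board n) : Prop where
  length_eq : N = (board n).card
  injective : Function.Injective a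
  adj : ∀ i, (knightGraph n).Adj (a i) (a (i + 1))

/-- The indicator of the coordinates where `c` is `±1`. -/
def dirOne {k : ℕ} (c : Fin k → ℤ) : Fin k → ℤ :=
  fun i => if c i = 1 ∨ c i = -1 then 1 else 0

/-- The indicator of the coordinates where `c` is `±2`. -/
def dirTwo {k : ℕ} (c : Fin k → ℤ) : Fin k → ℤ :=
  fun i => if c i = 2 ∨ c i = -2 then 1 else 0

/-- The move `c` with its `±1` coordinate flipped. -/
def flipOne {k : ℕ} (c : Fin k → ℤ) : Fin k → ℤ :=
  -((c ⬝ᵥ dirOne c) • dirOne c) + (c ⬝ᵥ dirTwo c) • dirTwo c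

/-- `v = ±2 eᵢ` for some vector `eᵢ` of the canonical basis. -/
def IsTwoStep {k : ℕ} (v : Fin k → ℤ) : Prop :=
  ∃ i, v = Pi.single i 2 ∨ v = Pi.single i (-2)

section Patterns

variable {k : ℕ} {n : Fin k → ℕ} {N : ℕ}

/-- Well-oriented parallel-pattern formed by the edges `a r → a (r+1)` and `a s → a (s+1)`. -/
def IsWopp (a : ZMod N → board n) (r s : ZMod N) : Prop :=
  ∃ c ∈ knightMoves k,
    (a (r + 1)).1 = (a r).1 + c ∧ (a s).1 = (a (s + 1)).1 + c ∧
    (a s).1 - (a (r + 1)).1 = (a (s + 1)).1 - (a r).1 ∧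
    IsTwoStep ((a (s + 1)).1 - (a r).1)

/-- Non-well-oriented parallel-pattern. -/
def IsNwopp (a : ZMod N → board n) (r s : ZMod N) : Prop :=
  ∃ c ∈ knightMoves k,
    (a (r + 1)).1 = (a r).1 + c ∧ (a (s + 1)).1 = (a s).1 + c ∧
    (a s).1 - (a r).1 = (a (s + 1)).1 - (a (r + 1)).1 ∧
    IsTwoStep ((a s).1 - (a r).1)

/-- Well-oriented cross-pattern. -/
def IsWocp (a : ZMod N → board n) (r s : ZMod N) : Prop :=
  ∃ c ∈ knightMoves k,
    (a (r + 1)).1 = (a r).1 + c ∧ (a (s + 1)).1 = (a s).1 + flipOne c ∧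
    (a s).1 - (a r).1 = (c ⬝ᵥ dirOne c) • dirOne c

/-- Non-well-oriented cross-pattern. -/
def IsNwocp (a : ZMod N → board n) (r s : ZMod N) : Prop :=
  ∃ c ∈ knightMoves k,
    (a (r + 1)).1 = (a r).1 + c ∧ (a s).1 = (a (s + 1)).1 + flipOne c ∧
    (a (s + 1)).1 - (a r).1 = (c ⬝ᵥ dirOne c) • dirOne c

/-- The edges `{a r, a (r+1)}` and `{a s, a (s+1)}` of the tour form a site. -/
def IsSite (a : ZMod N → board n) (r s : ZMod N) : Prop :=
  IsWocp a r s ∨ IsWopp a r s ∨ IsNwocp a r s ∨ IsNwopp a r s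

/-- The two endpoints of the edge of the cyclic sequence `a` that starts at index `r`. -/
def edgeSupport (a : ZMod N → board n) (r : ZMod N) : Finset (board n) :=
  {a r, a (r + 1)}

/-- The sequence `a` contains two sites such that the four edges involved have pairwise
disjoint sets of endpoints. -/
def IsBiSited (a : ZMod N → board n) : Prop :=
  ∃ r s t u : ZMod N, IsSite a r s ∧ IsSite a t u ∧
    [edgeSupport a r, edgeSupport a s, edgeSupport a t, edgeSupport a u].Pairwise Disjoint

end Patterns

/-- The board of size `n` has a bi-sited closed knight tour. -/
def HasBiSitedClosedTour {k : ℕ} (n : Fin k → ℕ) : Prop :=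
  ∃ (N : ℕ) (a : ZMod N → board n), IsClosedTour n a ∧ IsBiSited a

/-! A closed tour forces the stated conditions. A knight move changes the parity of the sum of the
coordinates, so the number of squares is even (`IsClosedTour.even_card`). If `m = n = 2`, the parity
of the third coordinate never changes along a tour (`not_isClosedTour_two_two`). If `p ≤ 3` and the
other two conditions hold, the board is `2 × 3 × 3`, which has an isolated square
(`not_isClosedTour_two_three_three`).

Conversely, two closed tours of disjoint sets merge into one when there are edges `s(a, b)` and
`s(c, d)` of the two tours such that `a` is adjacent to `c` and `b` to `d`
(`HasTour.merge`). If the tour of an `m × n × p` box uses the edge from `(1, 1, p)` to `(2, 3, p)`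
on its top layer, and the tour of an `m × n × q` box uses the edge from `(2, 1, 1)` to `(1, 3, 1)`
on its bottom layer, the two boxes can be stacked (`HasTour.stack`). The images of these edges under a
permutation of the axes serve in the same way to attach boxes along the other axes. A box is called
extendable (`IsExtendable`, or `IsThinExtendable` for the boxes of thickness `2`, which are
extended along two axes only) if it has a tour through the attaching edges of all the axes, along
with two disjoint sites that avoid the attaching edges at the far ends. Stacking two extendable
boxes gives an extendable box: of the first tour only the far attaching edge of the axis at hand is
lost, and the second tour supplies its replacement.

By induction on the side lengths, all boxes with the stated conditions are extendable once a few
small ones are, and for these explicit tours are given, checked by evaluation. The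
only exception is the `2 × 3 × 6` box: it is not obtained by stacking and no other box is built from
it, so that it needs just a bi-sited tour. -/

/-! ### Closed knight tours of sets of cells -/

/-- A cell of the three-dimensional lattice. -/
abbrev Cell := ℤ × ℤ × ℤ

/-- Two cells are a knight move apart. Since `5 = 0 + 1 + 4` is the only way to write `5` as a
sum of three squares, this says that the squared distance is `5`. -/
def KnightAdj (a b : Cell) : Prop :=
  (a.1 - b.1) * (a.1 - b.1) + (a.2.1 - b.2.1) * (a.2.1 - b.2.1) +
    (a.2.2 - b.2.2) * (a.2.2 - b.2.2) = 5

instance : DecidableRel KnightAdj := fun _ _ => inferInstanceAs (Decidable (_ = _))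

theorem KnightAdj.symm {a b : Cell} (h : KnightAdj a b) : KnightAdj b a := by
  unfold KnightAdj at *
  linarith

/-- The set `S` of cells has a closed knight tour that runs through all the undirected edges
in `E`. A tour is a cyclic list; it runs from `x` to `y` when it can be read
as a list that starts with `y` and ends with `x`. -/
def HasTour (S : Set Cell) (E : Set (Sym2 Cell)) : Prop :=
  ∃ c : Cycle Cell, c.Nodup ∧ (∀ v, v ∈ c ↔ v ∈ S) ∧ c.Chain KnightAdj ∧
    ∀ e ∈ E, ∃ x y t, e = s(x, y) ∧ c = ((y :: (t ++ [x]) : List Cell) : Cycle Cell)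

theorem HasTour.mono {S : Set Cell} {E E' : Set (Sym2 Cell)} (h : HasTour S E) (hE : E' ⊆ E) :
    HasTour S E' := by
  obtain ⟨c, h1, h2, h3, h4⟩ := h
  exact ⟨c, h1, h2, h3, fun e he => h4 e (hE he)⟩

theorem HasTour.mem_of_mem_edge {S : Set Cell} {E : Set (Sym2 Cell)} (h : HasTour S E)
    {e : Sym2 Cell} (he : e ∈ E) {v : Cell} (hv : v ∈ e) : v ∈ S := by
  obtain ⟨c, -, h2, -, h4⟩ := h
  obtain ⟨x, y, t, rfl, rfl⟩ := h4 e he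
  rw [← h2]
  rcases Sym2.mem_iff.1 hv with rfl | rfl <;> simp

/-- A Hamiltonian path whose ends are a knight move apart closes up to a tour. -/
theorem HasTour.of_path {S : Set Cell} {E : Set (Sym2 Cell)} (l : List Cell) (hl : l.Nodup)
    (hS : ∀ v, v ∈ l ↔ v ∈ S) (hc : l.IsChain KnightAdj)
    (hclose : ∀ x ∈ l.getLast?, ∀ y ∈ l.head?, KnightAdj x y)
    (hE : ∀ e ∈ E, ∃ x y, e = s(x, y) ∧ [x, y] <:+: l) : HasTour S E := by
  refine ⟨(l : Cycle Cell), by simpa using hl, by simpa using hS, ?_, ?_⟩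
  · cases l with
    | nil => simp
    | cons a t =>
      rw [Cycle.chain_coe_cons, ← List.cons_append, List.isChain_append]
      exact ⟨hc, by simp, fun x hx y hy => hclose x hx y (by simpa using hy)⟩
  · intro e he
    obtain ⟨x, y, rfl, u, v, rfl⟩ := hE e he
    refine ⟨x, y, v ++ u, rfl, ?_⟩
    rw [Cycle.coe_eq_coe]
    have := List.isRotated_append (l := u ++ [x]) (l' := y :: v)
    simpa using this

/-- A tour cut open at one of its edges `s(a, b)` is a Hamiltonian path from `a` to `b` that
still runs through all the other edges. -/
theorem HasTour.exists_path {S : Set Cell} {E : Set (Sym2 Cell)} (h : HasTour S E) {a b : Cell}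
    (hab : s(a, b) ∈ E) : ∃ t : List Cell, (a :: (t ++ [b])).Nodup ∧
      (∀ v, v ∈ a :: (t ++ [b]) ↔ v ∈ S) ∧ (a :: (t ++ [b])).IsChain KnightAdj ∧
      ∀ e ∈ E, e ≠ s(a, b) → ∃ x y, e = s(x, y) ∧ [x, y] <:+: a :: (t ++ [b]) := by
  -- Reversing the path if necessary, it starts at `a`.
  suffices H : ∀ x y t, s(a, b) = s(x, y) → (y :: (t ++ [x])).Nodup →
      (∀ v, v ∈ y :: (t ++ [x]) ↔ v ∈ S) → (y :: (t ++ [x])).IsChain KnightAdj →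
      (∀ e ∈ E, e ≠ s(a, b) → ∃ x' y', e = s(x', y') ∧ [x', y'] <:+: y :: (t ++ [x])) →
      ∃ t : List Cell, (a :: (t ++ [b])).Nodup ∧
      (∀ v, v ∈ a :: (t ++ [b]) ↔ v ∈ S) ∧ (a :: (t ++ [b])).IsChain KnightAdj ∧
      ∀ e ∈ E, e ≠ s(a, b) → ∃ x y, e = s(x, y) ∧ [x, y] <:+: a :: (t ++ [b]) by
    obtain ⟨c, h1, h2, h3, h4⟩ := h
    obtain ⟨x, y, t, hxy, rfl⟩ := h4 _ hab
    refine H x y t hxy (by simpa using h1) (by simpa using h2) ?_ ?_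
    · rw [Cycle.chain_coe_cons, ← List.cons_append, List.isChain_append] at h3
      exact h3.1
    · intro e he hne
      obtain ⟨x', y', t', rfl, ht⟩ := h4 e he
      refine ⟨x', y', rfl, ?_⟩
      obtain ⟨n, hn, hrot⟩ := List.isRotated_iff_mod.1 (Cycle.coe_eq_coe.1 ht)
      rw [List.rotate_eq_drop_append_take hn] at hrot
      have hsplit := List.take_append_drop n (y :: (t ++ [x]))
      generalize List.take n (y :: (t ++ [x])) = u at *
      generalize List.drop n (y :: (t ++ [x])) = v at *
      have hwhole : y :: (t ++ [x]) ≠ y' :: (t' ++ [x']) := by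
        intro heq
        simp only [List.cons.injEq] at heq
        obtain ⟨rfl, heq⟩ := heq
        obtain ⟨-, rfl⟩ := List.append_singleton_inj.1 heq
        exact hne hxy.symm
      rcases List.eq_nil_or_concat u with rfl | ⟨u', p, rfl⟩
      · exact absurd (hsplit.symm.trans ((List.append_nil v).symm.trans hrot)) hwhole
      · rw [List.concat_eq_append] at *
        rcases v with _ | ⟨q, v'⟩
        · exact absurd (hsplit.symm.trans ((List.append_nil _).trans hrot)) hwhole
        · rw [List.cons_append, ← List.append_assoc, List.cons.injEq] at hrot
          obtain ⟨rfl, hrot⟩ := hrot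
          obtain ⟨-, rfl⟩ := List.append_singleton_inj.1 hrot
          rw [← hsplit]
          exact ⟨u', v', by simp⟩
  intro x y t hxy g1 g2 g3 g4
  rcases Sym2.eq_iff.1 hxy with ⟨rfl, rfl⟩ | ⟨rfl, rfl⟩
  · have hr : (b :: (t ++ [a])).reverse = a :: (t.reverse ++ [b]) := by simp
    refine ⟨t.reverse, ?_, ?_, ?_, ?_⟩
    · rw [← hr, List.nodup_reverse]; exact g1
    · intro v; rw [← hr, List.mem_reverse]; exact g2 v
    · rw [← hr, List.isChain_reverse]
      exact g3.imp fun _ _ h => h.symm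
    · intro e he hne
      obtain ⟨x', y', rfl, hi⟩ := g4 e he hne
      refine ⟨y', x', Sym2.eq_swap, ?_⟩
      rw [← hr]
      have := List.reverse_infix.2 hi
      simpa using this
  · exact ⟨t, g1, g2, g3, g4⟩

/-- Two tours of disjoint sets merge along edges `s(a, b)` and `s(c, d)` such that `a` is adjacent
to `c` and `b` to `d`: these two edges are replaced by `s(a, c)` and `s(b, d)`. -/
theorem HasTour.merge {S S' : Set Cell} {E E' : Set (Sym2 Cell)} (h : HasTour S E)
    (h' : HasTour S' E') (hd : Disjoint S S') {a b c d : Cell} (hab : s(a, b) ∈ E)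
    (hcd : s(c, d) ∈ E') (hac : KnightAdj a c) (hbd : KnightAdj b d) :
    HasTour (S ∪ S') (E \ {s(a, b)} ∪ E' \ {s(c, d)}) := by
  obtain ⟨t, h1, h2, h3, h4⟩ := h.exists_path hab
  obtain ⟨t', g1, g2, g3, g4⟩ := h'.exists_path (Sym2.eq_swap (a := c) ▸ hcd)
  refine HasTour.of_path ((a :: (t ++ [b])) ++ (d :: (t' ++ [c]))) ?_ ?_ ?_ ?_ ?_
  · refine List.nodup_append'.2 ⟨h1, g1, ?_⟩
    intro v hv hv'
    exact Set.disjoint_left.1 hd ((h2 v).1 hv) ((g2 v).1 hv')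
  · intro v
    rw [List.mem_append, h2, g2, Set.mem_union]
  · rw [List.isChain_append]
    refine ⟨h3, g3, ?_⟩
    intro x hx y hy
    rw [← List.cons_append, List.getLast?_concat] at hx
    simp at hx hy
    subst hx hy
    exact hbd
  · intro x hx y hy
    rw [← List.cons_append (a := d), ← List.append_assoc, List.getLast?_concat] at hx
    simp at hx hy
    subst hx hy
    exact hac.symm
  · rintro e (⟨he, hne⟩ | ⟨he, hne⟩)
    · obtain ⟨x, y, hxy, hi⟩ := h4 e he hne
      exact ⟨x, y, hxy, hi.trans (List.prefix_append _ _).isInfix⟩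
    · obtain ⟨x, y, hxy, hi⟩ := g4 e he (by rwa [Sym2.eq_swap])
      exact ⟨x, y, hxy, hi.trans (List.suffix_append _ _).isInfix⟩

/-- The image of a tour under an injective map that preserves knight moves. -/
theorem HasTour.map {S : Set Cell} {E : Set (Sym2 Cell)} (h : HasTour S E) (f : Cell → Cell)
    (hf : Function.Injective f) (hadj : ∀ a b, KnightAdj a b → KnightAdj (f a) (f b)) :
    HasTour (f '' S) (Sym2.map f '' E) := by
  obtain ⟨c, h1, h2, h3, h4⟩ := h
  refine ⟨c.map f, ?_, ?_, ?_, ?_⟩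
  · induction c using Quotient.inductionOn with
    | h l => exact List.Nodup.map hf (by simpa using h1)
  · intro v
    rw [Cycle.mem_map]
    simp [h2]
  · rw [Cycle.chain_map]
    exact h3.imp fun a b hab => hadj a b hab
  · rintro _ ⟨e, he, rfl⟩
    obtain ⟨x, y, t, rfl, rfl⟩ := h4 e he
    exact ⟨f x, f y, t.map f, by simp, by simp⟩

/-! ### From tours of boxes to bi-sited closed tours -/

/-- The cells of the `m × n × p` board, as triples. -/
def box (m n p : ℕ) : Set Cell :=
  {v | (1 ≤ v.1 ∧ v.1 ≤ m) ∧ (1 ≤ v.2.1 ∧ v.2.1 ≤ n) ∧ 1 ≤ v.2.2 ∧ v.2.2 ≤ p}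

/-- The vectors `±2 eᵢ`, singled out by their squared length. -/
def IsTwoStepCell (v : Cell) : Prop :=
  v.1 * v.1 + v.2.1 * v.2.1 + v.2.2 * v.2.2 = 4

/-- The set `K` of edges contains two sites with disjoint supports, both of them parallel
patterns: pairs of edges of which one is the translate of the other by `±2 eᵢ`. -/
def HasParallelSites (K : Set (Sym2 Cell)) : Prop :=
  ∃ x y v x' y' v' : Cell, IsTwoStepCell v ∧ IsTwoStepCell v' ∧
    [x, y, x + v, y + v, x', y', x' + v', y' + v'].Nodup ∧
    s(x, y) ∈ K ∧ s(x + v, y + v) ∈ K ∧ s(x', y') ∈ K ∧ s(x' + v', y' + v') ∈ K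

theorem mem_knightMoves_three {c : Fin 3 → ℤ} :
    c ∈ knightMoves 3 ↔ c 0 * c 0 + c 1 * c 1 + c 2 * c 2 = 5 := by
  simp only [knightMoves, Set.mem_ofPred_eq, Finset.card_filter, Fin.sum_univ_three]
  generalize c 0 = x
  generalize c 1 = y
  generalize c 2 = z
  constructor
  · rintro ⟨h0, h1, h2⟩
    have key : ∀ w : ℤ, w = 0 ∨ w = 1 ∨ w = -1 ∨ w = 2 ∨ w = -2 ∨
        (w ≠ 0 ∧ w ≠ 1 ∧ w ≠ -1 ∧ w ≠ 2 ∧ w ≠ -2) := by intro w; omega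
    rcases key x with rfl | rfl | rfl | rfl | rfl | hx <;>
    rcases key y with rfl | rfl | rfl | rfl | rfl | hy <;>
    rcases key z with rfl | rfl | rfl | rfl | rfl | hz <;> simp_all
  · intro h
    have hx : -2 ≤ x ∧ x ≤ 2 := by constructor <;> nlinarith [mul_self_nonneg y, mul_self_nonneg z]
    have hy : -2 ≤ y ∧ y ≤ 2 := by constructor <;> nlinarith [mul_self_nonneg x, mul_self_nonneg z]
    have hz : -2 ≤ z ∧ z ≤ 2 := by constructor <;> nlinarith [mul_self_nonneg y, mul_self_nonneg x]
    obtain ⟨hx, hx'⟩ := hx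
    obtain ⟨hy, hy'⟩ := hy
    obtain ⟨hz, hz'⟩ := hz
    interval_cases x <;> interval_cases y <;> interval_cases z <;> simp_all

theorem mem_board_three {m n p : ℕ} {v : Fin 3 → ℤ} :
    v ∈ board ![m, n, p] ↔ (v 0, v 1, v 2) ∈ box m n p := by
  simp [board, Fin.forall_fin_succ, box]

theorem isTwoStep_of_isTwoStepCell {v : Cell} (h : IsTwoStepCell v) :
    IsTwoStep ![v.1, v.2.1, v.2.2] := by
  obtain ⟨x, y, z⟩ := v
  simp only [IsTwoStepCell] at h
  have hx : -2 ≤ x ∧ x ≤ 2 := by constructor <;> nlinarith [mul_self_nonneg y, mul_self_nonneg z]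
  have hy : -2 ≤ y ∧ y ≤ 2 := by constructor <;> nlinarith [mul_self_nonneg x, mul_self_nonneg z]
  have hz : -2 ≤ z ∧ z ≤ 2 := by constructor <;> nlinarith [mul_self_nonneg y, mul_self_nonneg x]
  obtain ⟨hx, hx'⟩ := hx
  obtain ⟨hy, hy'⟩ := hy
  obtain ⟨hz, hz'⟩ := hz
  have key : (x = 0 ∧ y = 0 ∧ (z = 2 ∨ z = -2)) ∨ (x = 0 ∧ (y = 2 ∨ y = -2) ∧ z = 0) ∨
      ((x = 2 ∨ x = -2) ∧ y = 0 ∧ z = 0) := by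
    interval_cases x <;> interval_cases y <;> interval_cases z <;> simp_all
  clear h
  rcases key with ⟨rfl, rfl, h⟩ | ⟨rfl, h, rfl⟩ | ⟨h, rfl, rfl⟩
  · refine ⟨2, h.imp ?_ ?_⟩ <;> rintro rfl <;> ext i <;> fin_cases i <;> rfl
  · refine ⟨1, h.imp ?_ ?_⟩ <;> rintro rfl <;> ext i <;> fin_cases i <;> rfl
  · refine ⟨0, h.imp ?_ ?_⟩ <;> rintro rfl <;> ext i <;> fin_cases i <;> rfl

/-- A cell seen as a vector indexed by `Fin 3`. -/
def Cell.toVec (v : Cell) : Fin 3 → ℤ := ![v.1, v.2.1, v.2.2]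

theorem Cell.toVec_injective : Function.Injective Cell.toVec := by
  rintro ⟨x, y, z⟩ ⟨x', y', z'⟩ h
  have h0 := congrFun h 0
  have h1 := congrFun h 1
  have h2 := congrFun h 2
  simp only [Cell.toVec, Matrix.cons_val] at h0 h1 h2
  rw [h0, h1, h2]

theorem Cell.toVec_add (v w : Cell) : (v + w).toVec = v.toVec + w.toVec := by
  ext i
  fin_cases i <;> rfl

/-- Two edges of a closed tour, one of which is the translate of the other by `±2 eᵢ`, form a site
whatever the directions in which the tour runs through them. -/
theorem isSite_of_parallel {m n p N : ℕ} {a : ZMod N → board ![m, n, p]}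
    (ha : IsClosedTour ![m, n, p] a) {r s : ZMod N} {x y v : Cell} (hv : IsTwoStepCell v)
    (hr : s((a r).1, (a (r + 1)).1) = s(x.toVec, y.toVec))
    (hs : s((a s).1, (a (s + 1)).1) = s((x + v).toVec, (y + v).toVec)) : IsSite a r s := by
  have hc : (a (r + 1)).1 - (a r).1 ∈ knightMoves 3 := by
    have := knightMoves_neg (ha.adj r)
    rwa [neg_sub] at this
  have hv' : IsTwoStep v.toVec := isTwoStep_of_isTwoStepCell hv
  rw [Cell.toVec_add, Cell.toVec_add] at hs
  rcases Sym2.eq_iff.1 hr with ⟨h1, h2⟩ | ⟨h1, h2⟩ <;>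
  rcases Sym2.eq_iff.1 hs with ⟨h3, h4⟩ | ⟨h3, h4⟩
  · refine Or.inr (Or.inr (Or.inr ⟨_, hc, by abel, ?_, ?_, ?_⟩))
    · rw [h1, h2, h3, h4]; abel
    · rw [h1, h2, h3, h4]; abel
    · rw [h1, h3]; simpa using hv'
  · refine Or.inr (Or.inl ⟨_, hc, by abel, ?_, ?_, ?_⟩)
    · rw [h1, h2, h3, h4]; abel
    · rw [h1, h2, h3, h4]; abel
    · rw [h1, h4]; simpa using hv'
  · refine Or.inr (Or.inl ⟨_, hc, by abel, ?_, ?_, ?_⟩)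
    · rw [h1, h2, h3, h4]; abel
    · rw [h1, h2, h3, h4]; abel
    · rw [h1, h4]; simpa using hv'
  · refine Or.inr (Or.inr (Or.inr ⟨_, hc, by abel, ?_, ?_, ?_⟩))
    · rw [h1, h2, h3, h4]; abel
    · rw [h1, h2, h3, h4]; abel
    · rw [h1, h3]; simpa using hv'

theorem edgeSupport_disjoint {k N : ℕ} {n : Fin k → ℕ} {a : ZMod N → board n} {r s : ZMod N}
    {x y z w : Fin k → ℤ} (hr : s((a r).1, (a (r + 1)).1) = s(x, y))
    (hs : s((a s).1, (a (s + 1)).1) = s(z, w)) (hxz : x ≠ z) (hxw : x ≠ w) (hyz : y ≠ z)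
    (hyw : y ≠ w) : Disjoint (edgeSupport a r) (edgeSupport a s) := by
  rw [Finset.disjoint_left]
  intro v hv hv'
  have h1 : v.1 ∈ s(x, y) := by
    rw [← hr, Sym2.mem_iff]
    simp only [edgeSupport, Finset.mem_insert, Finset.mem_singleton] at hv
    exact hv.imp (congrArg _) (congrArg _)
  have h2 : v.1 ∈ s(z, w) := by
    rw [← hs, Sym2.mem_iff]
    simp only [edgeSupport, Finset.mem_insert, Finset.mem_singleton] at hv'
    exact hv'.imp (congrArg _) (congrArg _)
  rcases Sym2.mem_iff.1 h1 with h | h <;> rcases Sym2.mem_iff.1 h2 with h' | h' <;>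
    simp_all

theorem HasTour.hasBiSitedClosedTour {m n p : ℕ} {K : Set (Sym2 Cell)}
    (h : HasTour (box m n p) K) (hK : HasParallelSites K) :
    HasBiSitedClosedTour ![m, n, p] := by
  obtain ⟨x, y, v, x', y', v', hv, hv', hnd, e1, e2, e3, e4⟩ := hK
  obtain ⟨c, h1, h2, h3, h4⟩ := h
  obtain ⟨x₀, y₀, t, -, rfl⟩ := h4 _ e1
  set l : List Cell := y₀ :: (t ++ [x₀]) with hl
  have hpos : 0 < l.length := by simp [hl]
  have : NeZero l.length := ⟨hpos.ne'⟩
  rw [Cycle.nodup_coe_iff] at h1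
  simp only [Cycle.mem_coe_iff] at h2
  have hmem : ∀ i : ZMod l.length, (l[i.val]'(ZMod.val_lt i)).toVec ∈ board ![m, n, p] := by
    intro i
    rw [mem_board_three]
    exact (h2 _).1 (List.getElem_mem _)
  set a : ZMod l.length → board ![m, n, p] := fun i => ⟨_, hmem i⟩ with ha
  have ha_cast : ∀ k : ℕ, (a k).1 = (l[k % l.length]'(Nat.mod_lt _ hpos)).toVec := by
    intro k
    simp only [ha, ZMod.val_natCast]
  have hinj : Function.Injective a := by
    intro i j hij
    have := Cell.toVec_injective (congrArg Subtype.val hij)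
    exact ZMod.val_injective _ ((List.Nodup.getElem_inj_iff h1).1 this)
  have hsurj : Function.Surjective a := by
    rintro ⟨w, hw⟩
    obtain ⟨i, hi, hiw⟩ := List.mem_iff_getElem.1 ((h2 _).2 (mem_board_three.1 hw))
    refine ⟨(i : ZMod l.length), Subtype.ext ?_⟩
    rw [ha_cast]
    simp only [Nat.mod_eq_of_lt hi, hiw]
    ext j
    fin_cases j <;> rfl
  -- `a` runs through every edge that the cyclic list runs through
  have hedge : ∀ {x y : Cell}, s(x, y) ∈ K →
      ∃ r, s((a r).1, (a (r + 1)).1) = s(x.toVec, y.toVec) := by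
    intro x y hxy
    obtain ⟨u, w, t', huw, ht'⟩ := h4 _ hxy
    obtain ⟨k, hk⟩ := Cycle.coe_eq_coe.1 ht'
    have hlen : l.length = t'.length + 2 := by
      rw [← List.length_rotate l k, hk]; simp
    have hw : l[k % l.length]'(Nat.mod_lt _ hpos) = w := by
      have := List.getElem_rotate l k 0 (by rw [List.length_rotate]; exact hpos)
      simp only [hk, Nat.zero_add] at this
      exact this.symm
    have hu : l[(t'.length + 1 + k) % l.length]'(Nat.mod_lt _ hpos) = u := by
      have := List.getElem_rotate l k (t'.length + 1) (by rw [List.length_rotate]; omega)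
      simp only [hk] at this
      rw [← this]
      simp
    refine ⟨((t'.length + 1 + k : ℕ) : ZMod l.length), ?_⟩
    have hstep : ((t'.length + 1 + k : ℕ) : ZMod l.length) + 1 = ((k : ℕ) : ZMod l.length) := by
      have : ((l.length : ℕ) : ZMod l.length) = 0 := ZMod.natCast_self _
      rw [hlen] at this ⊢
      push_cast at this ⊢
      linear_combination this
    rw [hstep, ha_cast, ha_cast, hu, hw]
    rcases Sym2.eq_iff.1 huw with ⟨rfl, rfl⟩ | ⟨rfl, rfl⟩
    · rfl
    · exact Sym2.eq_swap
  have hchain : (l ++ [y₀]).IsChain KnightAdj := by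
    rw [Cycle.chain_coe_cons] at h3
    simpa [hl] using h3
  have hT : IsClosedTour ![m, n, p] a := by
    refine ⟨?_, hinj, ?_⟩
    · have := Fintype.card_of_bijective ⟨hinj, hsurj⟩
      rwa [ZMod.card, Fintype.card_coe] at this
    · intro i
      obtain ⟨k, hk, rfl⟩ : ∃ k : ℕ, k < l.length ∧ (k : ZMod l.length) = i :=
        ⟨i.val, ZMod.val_lt i, ZMod.natCast_zmod_val i⟩
      have hadj := List.isChain_iff_getElem.1 hchain k (by simpa using hk)
      have h5 : (l ++ [y₀])[k]'(by simp; omega) = l[k] := List.getElem_append_left hk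
      have h6 : (l ++ [y₀])[k + 1]'(by simpa using hk) =
          l[(k + 1) % l.length]'(Nat.mod_lt _ hpos) := by
        rcases Nat.lt_or_ge (k + 1) l.length with hlt | hge
        · rw [List.getElem_append_left hlt]
          simp only [Nat.mod_eq_of_lt hlt]
        · have hkl : k + 1 = l.length := by omega
          simp only [hkl, Nat.mod_self]
          simp [hl]
      rw [h5, h6] at hadj
      change (a (k : ZMod l.length)).1 - (a ((k : ZMod l.length) + 1)).1 ∈ knightMoves 3
      rw [← Nat.cast_succ, ha_cast, ha_cast, mem_knightMoves_three]
      simp only [Nat.mod_eq_of_lt hk]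
      exact hadj
  obtain ⟨r, hr⟩ := hedge e1
  obtain ⟨s, hs⟩ := hedge e2
  obtain ⟨t', ht⟩ := hedge e3
  obtain ⟨u, hu⟩ := hedge e4
  refine ⟨l.length, a, hT, r, s, t', u, isSite_of_parallel hT hv hr hs,
    isSite_of_parallel hT hv' ht hu, ?_⟩
  simp only [List.nodup_cons, List.mem_cons, List.not_mem_nil, or_false, not_or] at hnd
  have hne : ∀ {v w : Cell}, v ≠ w → v.toVec ≠ w.toVec := fun h => Cell.toVec_injective.ne h
  simp only [List.pairwise_cons, List.mem_cons, List.not_mem_nil, or_false, forall_eq_or_imp,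
    forall_eq, IsEmpty.forall_iff, implies_true, List.Pairwise.nil, and_true]
  refine ⟨⟨?_, ?_, ?_⟩, ⟨?_, ?_⟩, ?_⟩
  · apply edgeSupport_disjoint hr hs <;> apply hne <;> tauto
  · apply edgeSupport_disjoint hr ht <;> apply hne <;> tauto
  · apply edgeSupport_disjoint hr hu <;> apply hne <;> tauto
  · apply edgeSupport_disjoint hs ht <;> apply hne <;> tauto
  · apply edgeSupport_disjoint hs hu <;> apply hne <;> tauto
  · apply edgeSupport_disjoint ht hu <;> apply hne <;> tauto

/-! ### Boards without a closed tour -/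

section Necessity

variable {m n p N : ℕ} {a : ZMod N → board ![m, n, p]}

theorem card_board_three (m n p : ℕ) : (board ![m, n, p]).card = m * n * p := by
  simp [board, Fin.prod_univ_three, mul_assoc]

theorem IsClosedTour.surjective (ha : IsClosedTour ![m, n, p] a) (hN : N ≠ 0) :
    Function.Surjective a := by
  have : NeZero N := ⟨hN⟩
  refine ((Fintype.bijective_iff_injective_and_card a).2 ⟨ha.injective, ?_⟩).2
  rw [ZMod.card, Fintype.card_coe]
  exact ha.length_eq

theorem IsClosedTour.sq_dist (ha : IsClosedTour ![m, n, p] a) (i : ZMod N) :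
    ((a i).1 0 - (a (i + 1)).1 0) * ((a i).1 0 - (a (i + 1)).1 0) +
    ((a i).1 1 - (a (i + 1)).1 1) * ((a i).1 1 - (a (i + 1)).1 1) +
    ((a i).1 2 - (a (i + 1)).1 2) * ((a i).1 2 - (a (i + 1)).1 2) = 5 :=
  mem_knightMoves_three.1 (ha.adj i)

/-- A knight move changes the colour of the square, so a closed tour has even length. -/
theorem IsClosedTour.even_card (ha : IsClosedTour ![m, n, p] a) : Even (m * n * p) := by
  have hstep : ∀ k : ℕ, Even ((a (k : ZMod N)).1 0 + (a (k : ZMod N)).1 1 + (a (k : ZMod N)).1 2 -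
      ((a 0).1 0 + (a 0).1 1 + (a 0).1 2) - k) := by
    intro k
    induction k with
    | zero => simp
    | succ k ih =>
      have h := ha.sq_dist (k : ZMod N)
      rw [← Nat.cast_succ] at h
      obtain ⟨t, ht⟩ := ih
      have hsq : ∀ w : ℤ, ∃ u, w * (w - 1) = u + u := fun w => Int.even_mul_pred_self w
      obtain ⟨u₀, hu₀⟩ := hsq ((a (k : ZMod N)).1 0 - (a ((k + 1 : ℕ) : ZMod N)).1 0)
      obtain ⟨u₁, hu₁⟩ := hsq ((a (k : ZMod N)).1 1 - (a ((k + 1 : ℕ) : ZMod N)).1 1)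
      obtain ⟨u₂, hu₂⟩ := hsq ((a (k : ZMod N)).1 2 - (a ((k + 1 : ℕ) : ZMod N)).1 2)
      refine ⟨t - 3 + u₀ + u₁ + u₂, ?_⟩
      push_cast at *
      linear_combination ht - h + hu₀ + hu₁ + hu₂
  have h := hstep N
  rw [ZMod.natCast_self, sub_self, zero_sub, even_neg, Int.even_coe_nat] at h
  rwa [ha.length_eq, card_board_three] at h

/-- On a `2 × 2 × p` board every step of length `2` is along the third axis, so the parity of the
third coordinate never changes. -/
theorem not_isClosedTour_two_two {p N : ℕ} {a : ZMod N → board ![2, 2, p]} (hp : 2 ≤ p)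
    (ha : IsClosedTour ![2, 2, p] a) : False := by
  have hN : N ≠ 0 := by
    rw [ha.length_eq, card_board_three]
    omega
  have : NeZero N := ⟨hN⟩
  have hstep : ∀ k : ℕ, Even ((a (k : ZMod N)).1 2 - (a 0).1 2) := by
    intro k
    induction k with
    | zero => simp
    | succ k ih =>
      have h := ha.sq_dist (k : ZMod N)
      rw [← Nat.cast_succ] at h
      obtain ⟨⟨h1, h2⟩, ⟨h3, h4⟩, -⟩ := mem_board_three.1 (a (k : ZMod N)).2
      obtain ⟨⟨g1, g2⟩, ⟨g3, g4⟩, -⟩ := mem_board_three.1 (a ((k + 1 : ℕ) : ZMod N)).2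
      simp only [Nat.cast_ofNat] at h1 h2 h3 h4 g1 g2 g3 g4
      generalize (a (k : ZMod N)).1 0 = x at *
      generalize (a (k : ZMod N)).1 1 = y at *
      generalize (a (k : ZMod N)).1 2 = z at *
      generalize (a ((k + 1 : ℕ) : ZMod N)).1 0 = x' at *
      generalize (a ((k + 1 : ℕ) : ZMod N)).1 1 = y' at *
      generalize (a ((k + 1 : ℕ) : ZMod N)).1 2 = z' at *
      have hz : (z - z') * (z - z') ≠ 5 := by
        intro h5
        have : z - z' ≤ 2 := by nlinarith
        have : -2 ≤ z - z' := by nlinarith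
        generalize z - z' = w at *
        interval_cases w <;> omega
      have hE : Even (z - z') := by
        suffices Even ((z - z') * (z - z')) by simpa [Int.even_mul] using this
        have key : (x - x') * (x - x') + (y - y') * (y - y') ∈ ({0, 1, 2} : Set ℤ) := by
          interval_cases x <;> interval_cases x' <;> interval_cases y <;> interval_cases y' <;> simp
        have hw : (z - z') * (z - z') = 5 - ((x - x') * (x - x') + (y - y') * (y - y')) := by
          linarith
        rcases key with h0 | h0 | h0
        · exact absurd (by rw [hw, h0]; norm_num) hz
        · rw [hw, h0]; decide
        · exfalso
          rw [h0] at hw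
          have : z - z' ≤ 2 := by nlinarith
          have : -2 ≤ z - z' := by nlinarith
          generalize z - z' = w at *
          interval_cases w <;> omega
      have := ih.sub hE
      ring_nf at this ⊢
      exact this
  have hs := ha.surjective hN
  obtain ⟨i, hi⟩ := hs ⟨![1, 1, 1], mem_board_three.2 (by simp [box]; omega)⟩
  obtain ⟨j, hj⟩ := hs ⟨![1, 1, 2], mem_board_three.2 (by simp [box]; omega)⟩
  have h1 := hstep i.val
  have h2 := hstep j.val
  rw [ZMod.natCast_zmod_val, hi] at h1
  rw [ZMod.natCast_zmod_val, hj] at h2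
  have h3 := h2.sub h1
  simp at h3

/-- The centre of a `3 × 3` layer of the `2 × 3 × 3` board is isolated in the knight graph. -/
theorem not_isClosedTour_two_three_three {N : ℕ} {a : ZMod N → board ![2, 3, 3]}
    (ha : IsClosedTour ![2, 3, 3] a) : False := by
  have hN : N ≠ 0 := by
    rw [ha.length_eq, card_board_three]
    omega
  obtain ⟨i, hi⟩ := ha.surjective hN ⟨![1, 2, 2], mem_board_three.2 (by simp [box])⟩
  have h := ha.sq_dist i
  obtain ⟨⟨g1, g2⟩, ⟨g3, g4⟩, g5, g6⟩ := mem_board_three.1 (a (i + 1)).2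
  simp only [Nat.cast_ofNat] at g1 g2 g3 g4 g5 g6
  rw [hi] at h
  simp only [Matrix.cons_val] at h
  generalize (a (i + 1)).1 0 = x at *
  generalize (a (i + 1)).1 1 = y at *
  generalize (a (i + 1)).1 2 = z at *
  interval_cases x <;> interval_cases y <;> interval_cases z <;> omega

end Necessity

/-! ### Stacking two boxes -/

/-- The translation by `p` along the third axis. -/
def shift (p : ℕ) (v : Cell) : Cell := (v.1, v.2.1, v.2.2 + p)

/-- The edge on the bottom layer of a box along which another box can be attached below: the two
ends of `low` are adjacent to those of the edge `high p` of a box of height `p` beneath. -/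
def low : Sym2 Cell := s((2, 1, 1), (1, 3, 1))

/-- The edge on the top layer of a box of height `p` along which another box can be attached
above. -/
def high (p : ℕ) : Sym2 Cell := s((1, 1, (p : ℤ)), (2, 3, (p : ℤ)))

theorem shift_injective (p : ℕ) : Function.Injective (shift p) := by
  rintro ⟨x, y, z⟩ ⟨x', y', z'⟩ h
  simpa [shift] using h

theorem map_shift_high (p q : ℕ) : Sym2.map (shift p) (high q) = high (p + q) := by
  simp [shift, high, add_comm]

theorem box_union_shift_box (m n p q : ℕ) :
    box m n p ∪ shift p '' box m n q = box m n (p + q) := by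
  ext ⟨x, y, z⟩
  simp only [Set.mem_union, Set.mem_image, box, Set.mem_ofPred_eq, shift, Prod.exists,
    Prod.mk.injEq]
  constructor
  · rintro (h | ⟨x', y', z', h, rfl, rfl, rfl⟩)
    · omega
    · omega
  · intro h
    by_cases hz : z ≤ p
    · left
      omega
    · right
      exact ⟨x, y, z - p, by omega, rfl, rfl, by omega⟩

/-- Two tours of boxes with the same base merge into a tour of the stack of the two boxes. -/
theorem HasTour.stack {m n p q : ℕ} {E E' : Set (Sym2 Cell)} (h : HasTour (box m n p) E)
    (h' : HasTour (box m n q) E') (hE : high p ∈ E) (hE' : low ∈ E') :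
    HasTour (box m n (p + q)) (E \ {high p} ∪ Sym2.map (shift p) '' (E' \ {low})) := by
  have hs : HasTour (shift p '' box m n q) (Sym2.map (shift p) '' E') :=
    h'.map (shift p) (shift_injective p) (fun a b hab => by
      unfold KnightAdj shift at *
      linarith)
  have hdisj : Disjoint (box m n p) (shift p '' box m n q) := by
    rw [Set.disjoint_left]
    rintro _ ⟨-, -, -, h1⟩ ⟨v, ⟨-, -, h2, -⟩, rfl⟩
    simp only [shift] at h1
    omega
  have hlow : Sym2.map (shift p) low = s(((1 : ℤ), (3 : ℤ), (1 + p : ℤ)), (2, 1, (1 + p : ℤ))) := by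
    simp only [low, shift, Sym2.map_mk]
    exact Sym2.eq_swap
  have hmem : Sym2.map (shift p) low ∈ Sym2.map (shift p) '' E' := ⟨_, hE', rfl⟩
  rw [hlow] at hmem
  have := h.merge hs hdisj hE hmem (by simp [KnightAdj]) (by simp [KnightAdj])
  rw [box_union_shift_box] at this
  refine this.mono (Set.union_subset_union_right _ ?_)
  rintro _ ⟨e, ⟨he, hne⟩, rfl⟩
  refine ⟨⟨e, he, rfl⟩, fun heq => hne ?_⟩
  rw [Set.mem_singleton_iff, ← hlow] at heq
  exact Sym2.map.injective (shift_injective p) heq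

theorem HasParallelSites.map {K : Set (Sym2 Cell)} (h : HasParallelSites K) (f : Cell → Cell)
    (hf : Function.Injective f) (hadd : ∀ v w, f (v + w) = f v + f w)
    (htwo : ∀ v, IsTwoStepCell v → IsTwoStepCell (f v)) : HasParallelSites (Sym2.map f '' K) := by
  obtain ⟨x, y, v, x', y', v', hv, hv', hnd, e1, e2, e3, e4⟩ := h
  refine ⟨f x, f y, f v, f x', f y', f v', htwo v hv, htwo v' hv', ?_, ⟨_, e1, rfl⟩,
    ⟨_, e2, by simp [hadd]⟩, ⟨_, e3, rfl⟩, ⟨_, e4, by simp [hadd]⟩⟩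
  simpa [hadd] using hnd.map hf

/-- The exchange of the second and third axes. -/
def swapAxes (v : Cell) : Cell := (v.1, v.2.2, v.2.1)

theorem swapAxes_involutive : Function.Involutive swapAxes := fun _ => rfl

/-- The rotation of the axes that sends the third axis to the first one. -/
def rotAxes (v : Cell) : Cell := (v.2.2, v.1, v.2.1)

theorem rotAxes_injective : Function.Injective rotAxes := by
  rintro ⟨x, y, z⟩ ⟨x', y', z'⟩ h
  simp only [rotAxes, Prod.mk.injEq] at h ⊢
  tauto

/-- The `2 × n × p` box has a tour that can be extended along its second and third axes: it runs
through the edges needed to attach boxes on either side, and it has two disjoint sites that survive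
the attachment of a box at the far ends. -/
def IsThinExtendable (n p : ℕ) : Prop :=
  ∃ K, HasParallelSites K ∧ high p ∉ K ∧ Sym2.map swapAxes (high n) ∉ K ∧
    HasTour (box 2 n p)
      (K ∪ {low, Sym2.map swapAxes low, high p, Sym2.map swapAxes (high n)})

/-- The `m × n × p` box has a tour that can be extended along its three axes: it runs
through the edges needed to attach boxes on either side, and it has two disjoint sites that survive
the attachment of a box at the far ends. -/
def IsExtendable (m n p : ℕ) : Prop :=
  ∃ K, HasParallelSites K ∧ high p ∉ K ∧ Sym2.map rotAxes (high m) ∉ K ∧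
    Sym2.map rotAxes (Sym2.map rotAxes (high n)) ∉ K ∧
    HasTour (box m n p)
      (K ∪ {low, Sym2.map rotAxes low, Sym2.map rotAxes (Sym2.map rotAxes low), high p,
        Sym2.map rotAxes (high m), Sym2.map rotAxes (Sym2.map rotAxes (high n))})

theorem IsThinExtendable.symm {n p : ℕ} (h : IsThinExtendable n p) : IsThinExtendable p n := by
  obtain ⟨K, h1, h2, h3, h4⟩ := h
  have hinv : ∀ e, Sym2.map swapAxes (Sym2.map swapAxes e) = e := by
    intro e
    rw [Sym2.map_map, swapAxes_involutive.comp_self, Sym2.map_id, id]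
  have hinj := Sym2.map.injective swapAxes_involutive.injective
  refine ⟨Sym2.map swapAxes '' K, h1.map _ swapAxes_involutive.injective (fun _ _ => rfl) ?_,
    ?_, ?_, ?_⟩
  · intro v hv
    unfold IsTwoStepCell swapAxes at *
    linarith
  · rintro ⟨e, he, hh⟩
    apply h3
    rwa [← hh, hinv]
  · rintro ⟨e, he, hh⟩
    exact h2 (hinj hh ▸ he)
  · have := h4.map swapAxes swapAxes_involutive.injective (fun a b hab => by
      unfold KnightAdj swapAxes at *
      linarith)
    have hb : swapAxes '' box 2 n p = box 2 p n := by
      ext ⟨x, y, z⟩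
      rw [swapAxes_involutive.image_eq_preimage_symm]
      simp only [box, swapAxes, Set.mem_preimage, Set.mem_ofPred_eq]
      tauto
    rw [hb] at this
    refine this.mono ?_
    simp only [Set.image_union, Set.image_insert_eq, Set.image_singleton, hinv]
    refine Set.union_subset_union_right _ ?_
    intro e he
    simp only [Set.mem_insert_iff, Set.mem_singleton_iff] at he ⊢
    tauto

theorem IsExtendable.rotate {m n p : ℕ} (h : IsExtendable m n p) : IsExtendable p m n := by
  obtain ⟨K, h1, h2, h3, h3', h4⟩ := h
  have hrot : ∀ e, Sym2.map rotAxes (Sym2.map rotAxes (Sym2.map rotAxes e)) = e := by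
    intro e
    rw [Sym2.map_map, Sym2.map_map]
    exact Sym2.map_id' ▸ rfl
  have hinj := Sym2.map.injective rotAxes_injective
  refine ⟨Sym2.map rotAxes '' K, h1.map _ rotAxes_injective (fun _ _ => rfl) ?_,
    ?_, ?_, ?_, ?_⟩
  · intro v hv
    unfold IsTwoStepCell rotAxes at *
    linarith
  · rintro ⟨e, he, hh⟩
    apply h3'
    rwa [← hh, hrot]
  · rintro ⟨e, he, hh⟩
    exact h2 (hinj hh ▸ he)
  · rintro ⟨e, he, hh⟩
    exact h3 (hinj hh ▸ he)
  · have := h4.map rotAxes rotAxes_injective (fun a b hab => by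
      unfold KnightAdj rotAxes at *
      linarith)
    have hb : rotAxes '' box m n p = box p m n := by
      ext ⟨x, y, z⟩
      simp only [Set.mem_image, box, rotAxes, Set.mem_ofPred_eq, Prod.exists, Prod.mk.injEq]
      constructor
      · rintro ⟨x', y', z', h, rfl, rfl, rfl⟩
        tauto
      · intro h
        exact ⟨y, z, x, by tauto, rfl, rfl, rfl⟩
    rw [hb] at this
    refine this.mono ?_
    simp only [Set.image_union, Set.image_insert_eq, Set.image_singleton, hrot]
    refine Set.union_subset_union_right _ ?_
    intro e he
    simp only [Set.mem_insert_iff, Set.mem_singleton_iff] at he ⊢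
    tauto

/-- An edge with an end above height `p` is not an edge of a tour of a box of height `p`. -/
theorem HasTour.high_notMem {m n p q : ℕ} {K : Set (Sym2 Cell)} (h : HasTour (box m n p) K)
    (hq : 0 < q) : high (p + q) ∉ K := by
  intro hmem
  obtain ⟨-, -, -, h1⟩ := h.mem_of_mem_edge hmem (Sym2.mem_mk_left _ _)
  simp only at h1
  omega

theorem IsThinExtendable.stack {n p q : ℕ} (hq : 0 < q) (h : IsThinExtendable n p)
    (h' : IsThinExtendable n q) : IsThinExtendable n (p + q) := by
  obtain ⟨K, h1, h2, h3, h4⟩ := h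
  obtain ⟨K', -, -, -, h4'⟩ := h'
  refine ⟨K, h1, (h4.mono Set.subset_union_left).high_notMem hq, h3, ?_⟩
  refine (h4.stack h4' (by simp) (by simp)).mono ?_
  rintro e (he | he)
  · exact Or.inl ⟨Or.inl he, fun hh => h2 (hh ▸ he)⟩
  · simp only [Set.mem_insert_iff, Set.mem_singleton_iff] at he
    rcases he with rfl | rfl | rfl | rfl
    · exact Or.inl ⟨by simp, by simp [low, high]⟩
    · exact Or.inl ⟨by simp, by simp [low, high, swapAxes]⟩
    · exact Or.inr ⟨high q, ⟨by simp, by simp [low, high]⟩, map_shift_high p q⟩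
    · exact Or.inl ⟨by simp, by simp [high, swapAxes]; omega⟩

theorem IsExtendable.stack {m n p q : ℕ} (hq : 0 < q) (h : IsExtendable m n p)
    (h' : IsExtendable m n q) : IsExtendable m n (p + q) := by
  obtain ⟨K, h1, h2, h3, h3', h4⟩ := h
  obtain ⟨K', -, -, -, -, h4'⟩ := h'
  refine ⟨K, h1, (h4.mono Set.subset_union_left).high_notMem hq, h3, h3', ?_⟩
  refine (h4.stack h4' (by simp) (by simp)).mono ?_
  rintro e (he | he)
  · exact Or.inl ⟨Or.inl he, fun hh => h2 (hh ▸ he)⟩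
  · simp only [Set.mem_insert_iff, Set.mem_singleton_iff] at he
    rcases he with rfl | rfl | rfl | rfl | rfl | rfl
    · exact Or.inl ⟨by simp, by simp [low, high]⟩
    · exact Or.inl ⟨by simp, by simp [low, high, rotAxes]⟩
    · exact Or.inl ⟨by simp, by simp [low, high, rotAxes]⟩
    · exact Or.inr ⟨high q, ⟨by simp, by simp [low, high]⟩, map_shift_high p q⟩
    · exact Or.inl ⟨by simp, by simp [high, rotAxes]⟩
    · exact Or.inl ⟨by simp, by simp [high, rotAxes]⟩

/-! ### Explicit tours of small boxes -/

/-- The cell with the three decimal digits of `c` as coordinates. -/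
def cellOfDigits (c : ℕ) : Cell := ((c / 100 : ℕ), (c / 10 % 10 : ℕ), (c % 10 : ℕ))

/-- The set of undirected edges given by a list of pairs of cells. -/
def edgeSet (L : List (Cell × Cell)) : Set (Sym2 Cell) := {e | ∃ q ∈ L, s(q.1, q.2) = e}

/-- The list `l` goes once through each cell of the `m × n × p` box, by knight moves, its last
cell is adjacent to its first one, and it runs through the edges in `L`. -/
def IsTourList (m n p : ℕ) (l : List Cell) (L : List (Cell × Cell)) : Prop :=
  l.length = m * n * p ∧ l.Nodup ∧
  (∀ v ∈ l, (1 ≤ v.1 ∧ v.1 ≤ m) ∧ (1 ≤ v.2.1 ∧ v.2.1 ≤ n) ∧ 1 ≤ v.2.2 ∧ v.2.2 ≤ p) ∧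
  l.IsChain KnightAdj ∧ (∀ x ∈ l.getLast?, ∀ y ∈ l.head?, KnightAdj x y) ∧
  ∀ q ∈ L, [q.1, q.2] <:+: l ∨ [q.2, q.1] <:+: l

instance (m n p : ℕ) (l : List Cell) (L : List (Cell × Cell)) :
    Decidable (IsTourList m n p l L) := by
  unfold IsTourList
  infer_instance

/-- The four edges of two parallel patterns. -/
def siteList (x y v x' y' v' : Cell) : List (Cell × Cell) :=
  [(x, y), (x + v, y + v), (x', y'), (x' + v', y' + v')]

/-- The edges `s(x, y)` and `s(x', y')` and their translates by `v` and `v'` form two parallel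
patterns with disjoint supports. This is a decidable restatement of the conditions in
`HasParallelSites`. -/
def AreDisjointSites (x y v x' y' v' : Cell) : Prop :=
  v.1 * v.1 + v.2.1 * v.2.1 + v.2.2 * v.2.2 = 4 ∧
  v'.1 * v'.1 + v'.2.1 * v'.2.1 + v'.2.2 * v'.2.2 = 4 ∧
  [x, y, x + v, y + v, x', y', x' + v', y' + v'].Nodup

instance (x y v x' y' v' : Cell) : Decidable (AreDisjointSites x y v x' y' v') := by
  unfold AreDisjointSites
  infer_instance

theorem AreDisjointSites.hasParallelSites {x y v x' y' v' : Cell}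
    (h : AreDisjointSites x y v x' y' v') :
    HasParallelSites (edgeSet (siteList x y v x' y' v')) :=
  ⟨x, y, v, x', y', v', h.1, h.2.1, h.2.2, by simp [edgeSet, siteList],
    by simp [edgeSet, siteList], by simp [edgeSet, siteList], by simp [edgeSet, siteList]⟩

theorem IsTourList.hasTour {m n p : ℕ} {l : List Cell} {L : List (Cell × Cell)}
    (h : IsTourList m n p l L) : HasTour (box m n p) (edgeSet L) := by
  obtain ⟨h1, h2, h3, h4, h5, h6⟩ := h
  refine HasTour.of_path l h2 ?_ h4 h5 ?_
  · -- `l` visits as many cells as the box has, hence all of them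
    set B : Finset Cell := Finset.Icc (1 : ℤ) m ×ˢ Finset.Icc (1 : ℤ) n ×ˢ Finset.Icc (1 : ℤ) p
      with hB
    have hBmem : ∀ v, v ∈ B ↔ v ∈ box m n p := by
      intro v
      simp [hB, box]
    have hsub : l.toFinset ⊆ B := by
      intro v hv
      exact (hBmem v).2 (h3 v (List.mem_toFinset.1 hv))
    have heq := Finset.eq_of_subset_of_card_le hsub (by
      rw [List.toFinset_card_of_nodup h2, h1]
      simp [hB, mul_assoc])
    intro v
    rw [← hBmem, ← heq, List.mem_toFinset]
  · rintro _ ⟨q, hq, rfl⟩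
    rcases h6 q hq with h | h
    · exact ⟨_, _, rfl, h⟩
    · exact ⟨_, _, Sym2.eq_swap, h⟩

theorem hasBiSitedClosedTour_of_list {m n p : ℕ} (l : List ℕ) (x y v x' y' v' : Cell)
    (h : AreDisjointSites x y v x' y' v' ∧
      IsTourList m n p (l.map cellOfDigits) (siteList x y v x' y' v')) :
    HasBiSitedClosedTour ![m, n, p] :=
  h.2.hasTour.hasBiSitedClosedTour h.1.hasParallelSites

theorem IsThinExtendable.of_list {n p : ℕ} (l : List ℕ) (x y v x' y' v' : Cell)
    (h : AreDisjointSites x y v x' y' v' ∧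
      (∀ q ∈ siteList x y v x' y' v', s(q.1, q.2) ≠ high p ∧
        s(q.1, q.2) ≠ Sym2.map swapAxes (high n)) ∧
      IsTourList 2 n p (l.map cellOfDigits) (siteList x y v x' y' v' ++
        [((2, 1, 1), (1, 3, 1)), ((2, 1, 1), (1, 1, 3)), ((1, 1, (p : ℤ)), (2, 3, (p : ℤ))),
          ((1, (n : ℤ), 1), (2, (n : ℤ), 3))])) : IsThinExtendable n p := by
  obtain ⟨h1, h2, h3⟩ := h
  refine ⟨_, h1.hasParallelSites, ?_, ?_, h3.hasTour.mono ?_⟩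
  · rintro ⟨q, hq, hh⟩
    exact (h2 q hq).1 hh
  · rintro ⟨q, hq, hh⟩
    exact (h2 q hq).2 hh
  · rintro e (⟨q, hq, rfl⟩ | he)
    · exact ⟨q, List.mem_append_left _ hq, rfl⟩
    · simp only [Set.mem_insert_iff, Set.mem_singleton_iff] at he
      rcases he with rfl | rfl | rfl | rfl
      · exact ⟨((2, 1, 1), (1, 3, 1)), by simp, rfl⟩
      · exact ⟨((2, 1, 1), (1, 1, 3)), by simp, rfl⟩
      · exact ⟨((1, 1, (p : ℤ)), (2, 3, (p : ℤ))), by simp, rfl⟩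
      · exact ⟨((1, (n : ℤ), 1), (2, (n : ℤ), 3)), by simp, rfl⟩

theorem IsExtendable.of_list {m n p : ℕ} (l : List ℕ) (x y v x' y' v' : Cell)
    (h : AreDisjointSites x y v x' y' v' ∧
      (∀ q ∈ siteList x y v x' y' v', s(q.1, q.2) ≠ high p ∧
        s(q.1, q.2) ≠ Sym2.map rotAxes (high m) ∧
        s(q.1, q.2) ≠ Sym2.map rotAxes (Sym2.map rotAxes (high n))) ∧
      IsTourList m n p (l.map cellOfDigits) (siteList x y v x' y' v' ++
        [((2, 1, 1), (1, 3, 1)), ((1, 2, 1), (1, 1, 3)), ((1, 1, 2), (3, 1, 1)),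
          ((1, 1, (p : ℤ)), (2, 3, (p : ℤ))), (((m : ℤ), 1, 1), ((m : ℤ), 2, 3)),
          ((1, (n : ℤ), 1), (3, (n : ℤ), 2))])) : IsExtendable m n p := by
  obtain ⟨h1, h2, h3⟩ := h
  refine ⟨_, h1.hasParallelSites, ?_, ?_, ?_, h3.hasTour.mono ?_⟩
  · rintro ⟨q, hq, hh⟩
    exact (h2 q hq).1 hh
  · rintro ⟨q, hq, hh⟩
    exact (h2 q hq).2.1 hh
  · rintro ⟨q, hq, hh⟩
    exact (h2 q hq).2.2 hh
  · rintro e (⟨q, hq, rfl⟩ | he)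
    · exact ⟨q, List.mem_append_left _ hq, rfl⟩
    · simp only [Set.mem_insert_iff, Set.mem_singleton_iff] at he
      rcases he with rfl | rfl | rfl | rfl | rfl | rfl
      · exact ⟨((2, 1, 1), (1, 3, 1)), by simp, rfl⟩
      · exact ⟨((1, 2, 1), (1, 1, 3)), by simp, rfl⟩
      · exact ⟨((1, 1, 2), (3, 1, 1)), by simp, rfl⟩
      · exact ⟨((1, 1, (p : ℤ)), (2, 3, (p : ℤ))), by simp, rfl⟩
      · exact ⟨(((m : ℤ), 1, 1), ((m : ℤ), 2, 3)), by simp, rfl⟩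
      · exact ⟨((1, (n : ℤ), 1), (3, (n : ℤ), 2)), by simp, rfl⟩

theorem isThinExtendable_three_four : IsThinExtendable 3 4 :=
  IsThinExtendable.of_list
    [224, 122, 114, 234, 222, 124, 132, 111, 123, 221, 213, 133, 112, 232, 134, 214, 233, 131,
      211, 113, 121, 223, 231, 212]
    (1, 3, 1) (2, 1, 1) (0, 0, 2)
    (2, 1, 2) (2, 3, 1) (0, 0, 2) (by decide +kernel)

theorem isThinExtendable_three_five : IsThinExtendable 3 5 :=
  IsThinExtendable.of_list
    [111, 132, 124, 222, 234, 215, 135, 114, 212, 224, 122, 134, 115, 235, 214, 112, 232, 213,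
      221, 123, 225, 233, 131, 211, 113, 121, 133, 125, 223, 231]
    (2, 1, 3) (2, 3, 2) (0, 0, 2)
    (1, 2, 3) (2, 2, 1) (0, 0, 2) (by decide +kernel)

theorem isThinExtendable_three_seven : IsThinExtendable 3 7 :=
  IsThinExtendable.of_list
    [223, 231, 111, 132, 212, 224, 126, 114, 122, 134, 236, 217, 137, 116, 124, 222, 234, 226,
      214, 112, 232, 213, 221, 123, 115, 127, 225, 233, 131, 211, 113, 125, 227, 215, 135, 237,
      117, 136, 216, 235, 133, 121]
    (2, 2, 3) (2, 3, 1) (0, 0, 2)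
    (2, 1, 2) (2, 2, 4) (0, 0, 2) (by decide +kernel)

theorem isThinExtendable_four_four : IsThinExtendable 4 4 :=
  IsThinExtendable.of_list
    [224, 144, 242, 221, 123, 111, 231, 212, 114, 234, 132, 124, 143, 223, 244, 142, 222, 241,
      121, 133, 213, 232, 112, 131, 211, 113, 233, 214, 134, 122, 141, 243]
    (1, 2, 2) (1, 4, 1) (0, 0, 2)
    (2, 2, 1) (2, 4, 2) (0, 0, 2) (by decide +kernel)

theorem isThinExtendable_four_five : IsThinExtendable 4 5 :=
  IsThinExtendable.of_list
    [135, 114, 234, 242, 221, 141, 243, 145, 225, 213, 115, 235, 133, 231, 111, 123, 144, 132,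
      212, 224, 122, 134, 142, 121, 241, 222, 214, 112, 232, 244, 124, 143, 223, 125, 245, 233,
      131, 211, 113, 215]
    (1, 4, 1) (2, 2, 1) (0, 0, 2)
    (2, 1, 3) (2, 2, 5) (0, 2, 0) (by decide +kernel)

theorem isThinExtendable_five_five : IsThinExtendable 5 5 :=
  IsThinExtendable.of_list
    [153, 255, 135, 215, 113, 211, 131, 152, 254, 242, 144, 125, 245, 224, 122, 114, 212, 233,
      221, 141, 243, 145, 225, 123, 111, 132, 252, 154, 234, 213, 115, 235, 155, 134, 214, 222,
      142, 121, 241, 143, 124, 244, 223, 231, 151, 253, 133, 112, 232, 251]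
    (1, 3, 5) (2, 1, 5) (0, 2, 0)
    (1, 1, 3) (2, 1, 1) (0, 0, 2) (by decide +kernel)

theorem isThinExtendable_six_six : IsThinExtendable 6 6 :=
  IsThinExtendable.of_list
    [111, 231, 212, 114, 216, 136, 115, 213, 221, 141, 261, 163, 151, 253, 155, 235, 256, 264,
      166, 246, 265, 145, 126, 224, 122, 242, 162, 154, 252, 233, 225, 123, 144, 156, 135, 116,
      236, 215, 234, 255, 243, 262, 254, 266, 164, 152, 133, 112, 131, 211, 113, 125, 245, 226,
      214, 222, 124, 143, 223, 121, 241, 161, 263, 251, 232, 244, 142, 134, 146, 165, 153, 132]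
    (2, 1, 2) (2, 3, 1) (0, 2, 0)
    (1, 1, 5) (1, 3, 6) (0, 2, 0) (by decide +kernel)

theorem hasBiSitedClosedTour_two_three_six : HasBiSitedClosedTour ![2, 3, 6] :=
  hasBiSitedClosedTour_of_list
    [111, 231, 212, 224, 122, 114, 126, 134, 236, 116, 135, 215, 113, 125, 223, 121, 133, 235,
      216, 136, 115, 123, 225, 213, 221, 233, 131, 211, 232, 112, 124, 226, 214, 222, 234, 132]
    (2, 1, 2) (2, 2, 4) (0, 0, 2)
    (1, 1, 3) (2, 1, 5) (0, 2, 0) (by decide +kernel)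

theorem isExtendable_three_three_four : IsExtendable 3 3 4 :=
  IsExtendable.of_list
    [224, 322, 314, 124, 222, 234, 114, 324, 123, 221, 213, 111, 132, 333, 231, 223, 321, 122,
      134, 214, 334, 232, 312, 331, 233, 313, 112, 311, 323, 133, 121, 113, 211, 131, 332, 212]
    (1, 1, 2) (3, 1, 3) (0, 2, 0)
    (2, 1, 2) (3, 3, 2) (0, 0, 2) (by decide +kernel)

theorem isExtendable_three_four_four : IsExtendable 3 4 4 :=
  IsExtendable.of_list
    [314, 234, 114, 212, 224, 344, 242, 144, 334, 214, 112, 311, 323, 124, 132, 342, 141, 243,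
      222, 241, 143, 122, 321, 111, 231, 223, 244, 232, 213, 133, 121, 113, 312, 331, 211, 131,
      233, 221, 341, 333, 134, 324, 343, 142, 332, 313, 123, 322]
    (2, 1, 2) (2, 2, 4) (0, 2, 0)
    (1, 2, 2) (3, 2, 1) (0, 0, 2) (by decide +kernel)

theorem isExtendable_three_four_five : IsExtendable 3 4 5 :=
  IsExtendable.of_list
    [341, 221, 141, 342, 244, 225, 145, 335, 215, 135, 345, 243, 222, 142, 121, 113, 211, 131,
      112, 311, 323, 331, 233, 241, 343, 245, 125, 315, 235, 115, 314, 124, 143, 223, 325, 344,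
      242, 144, 224, 212, 231, 133, 334, 214, 134, 232, 213, 234, 132, 111, 321, 333, 312, 122,
      114, 324, 332, 313, 123, 322]
    (1, 4, 1) (2, 2, 1) (0, 0, 2)
    (1, 4, 2) (2, 2, 2) (0, 0, 2) (by decide +kernel)

theorem isExtendable_four_three_five : IsExtendable 4 3 5 :=
  IsExtendable.of_list
    [135, 325, 115, 235, 425, 215, 414, 435, 315, 125, 335, 415, 225, 424, 432, 411, 423, 224,
      322, 121, 113, 134, 122, 114, 324, 123, 111, 312, 214, 222, 124, 132, 234, 314, 434, 422,
      221, 323, 331, 233, 212, 413, 421, 231, 223, 321, 333, 431, 311, 112, 133, 213, 232, 433,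
      412, 332, 131, 211, 313, 334]
    (1, 2, 1) (3, 2, 2) (0, 0, 2)
    (1, 1, 3) (1, 3, 4) (2, 0, 0) (by decide +kernel)

theorem isExtendable_four_four_four : IsExtendable 4 4 4 :=
  IsExtendable.of_list
    [121, 113, 314, 434, 442, 241, 143, 124, 112, 311, 413, 214, 134, 344, 424, 412, 431, 443,
      244, 142, 341, 131, 211, 421, 323, 342, 141, 243, 222, 324, 444, 432, 411, 423, 233, 221,
      123, 333, 231, 111, 132, 331, 312, 414, 213, 234, 114, 133, 343, 144, 334, 232, 224, 212,
      332, 313, 433, 441, 422, 223, 321, 122, 242, 322]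
    (1, 1, 2) (3, 1, 1) (0, 2, 0)
    (4, 1, 2) (4, 2, 4) (0, 2, 0) (by decide +kernel)

theorem isExtendable_four_four_five : IsExtendable 4 4 5 :=
  IsExtendable.of_list
    [125, 315, 114, 135, 215, 414, 435, 245, 444, 425, 345, 144, 334, 342, 141, 133, 145, 225,
      415, 335, 314, 115, 235, 445, 325, 124, 143, 241, 431, 412, 211, 131, 112, 311, 213, 111,
      132, 234, 424, 214, 134, 344, 332, 313, 411, 423, 321, 122, 312, 333, 123, 324, 222, 142,
      343, 331, 323, 221, 233, 432, 413, 212, 224, 322, 242, 443, 341, 421, 442, 434, 244, 232,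
      422, 441, 433, 243, 231, 223, 121, 113]
    (1, 1, 3) (1, 2, 1) (0, 2, 0)
    (1, 1, 4) (1, 3, 5) (2, 0, 0) (by decide +kernel)

theorem isExtendable_four_five_five : IsExtendable 4 5 5 :=
  IsExtendable.of_list
    [441, 453, 445, 255, 454, 352, 151, 341, 421, 211, 131, 152, 351, 141, 153, 145, 355, 154,
      142, 121, 113, 125, 315, 435, 414, 215, 425, 413, 311, 112, 124, 314, 115, 235, 155, 134,
      254, 455, 335, 415, 214, 312, 111, 321, 122, 114, 135, 325, 313, 411, 423, 444, 245, 143,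
      344, 442, 434, 224, 212, 422, 324, 332, 353, 451, 252, 231, 243, 345, 333, 354, 452, 433,
      223, 244, 232, 253, 241, 431, 412, 222, 342, 132, 234, 213, 133, 334, 432, 424, 225, 323,
      443, 233, 221, 123, 144, 242, 322, 343, 331, 251]
    (1, 3, 1) (2, 1, 1) (0, 0, 2)
    (1, 2, 1) (1, 4, 2) (0, 0, 2) (by decide +kernel)

theorem isExtendable_three_three_six : IsExtendable 3 3 6 :=
  IsExtendable.of_list
    [216, 136, 326, 116, 236, 224, 126, 316, 115, 325, 223, 121, 113, 125, 315, 336, 135, 215,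
      335, 134, 232, 211, 131, 332, 122, 321, 313, 334, 322, 314, 212, 114, 133, 112, 311, 323,
      225, 233, 221, 123, 324, 226, 124, 222, 214, 312, 331, 132, 234, 213, 111, 231, 333, 235]
    (1, 1, 5) (3, 1, 6) (0, 2, 0)
    (1, 1, 3) (1, 2, 1) (2, 0, 0) (by decide +kernel)

theorem isExtendable_three_five_six : IsExtendable 3 5 6 :=
  IsExtendable.of_list
    [141, 221, 242, 122, 312, 111, 321, 241, 222, 342, 152, 254, 156, 355, 253, 151, 352, 331,
      251, 131, 211, 232, 112, 311, 323, 225, 246, 326, 116, 236, 356, 155, 345, 146, 226, 214,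
      316, 126, 224, 245, 143, 344, 336, 216, 114, 315, 213, 115, 235, 256, 136, 346, 244, 324,
      134, 153, 145, 243, 341, 353, 255, 135, 154, 142, 121, 113, 125, 223, 215, 234, 354, 335,
      343, 133, 332, 252, 233, 313, 325, 124, 334, 144, 123, 322, 314, 333, 132, 212, 231, 351]
    (1, 1, 6) (3, 2, 6) (0, 2, 0)
    (2, 1, 6) (3, 3, 6) (0, 2, 0) (by decide +kernel)

theorem isExtendable_five_three_six : IsExtendable 5 3 6 :=
  IsExtendable.of_list
    [321, 511, 523, 531, 411, 221, 431, 232, 422, 212, 132, 111, 231, 421, 211, 131, 332, 122,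
      114, 126, 134, 115, 136, 216, 426, 236, 116, 135, 123, 225, 415, 535, 516, 436, 316, 526,
      336, 416, 536, 515, 435, 234, 226, 124, 325, 524, 512, 533, 521, 423, 222, 324, 514, 412,
      213, 311, 112, 313, 215, 414, 534, 333, 532, 322, 224, 425, 433, 513, 525, 326, 314, 335,
      125, 315, 323, 113, 121, 133, 334, 432, 424, 223, 235, 434, 413, 214, 233, 331, 312, 522]
    (1, 2, 2) (3, 3, 2) (2, 0, 0)
    (1, 1, 4) (1, 2, 6) (2, 0, 0) (by decide +kernel)

theorem isExtendable_five_five_six : IsExtendable 5 5 6 :=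
  IsExtendable.of_list
    [351, 541, 522, 514, 526, 446, 256, 136, 115, 316, 126, 145, 153, 141, 122, 114, 216, 415,
      513, 521, 311, 112, 131, 211, 412, 431, 551, 532, 511, 523, 515, 536, 416, 226, 146, 154,
      252, 451, 553, 455, 436, 516, 535, 556, 544, 525, 546, 356, 555, 534, 542, 554, 456, 246,
      326, 116, 236, 156, 346, 426, 225, 424, 214, 312, 111, 321, 531, 411, 221, 213, 414, 512,
      313, 215, 113, 121, 241, 442, 421, 341, 151, 352, 331, 251, 452, 354, 155, 134, 142, 123,
      322, 132, 212, 314, 124, 222, 432, 231, 441, 242, 144, 152, 254, 453, 355, 336, 135, 345,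
      324, 125, 315, 413, 533, 332, 434, 233, 335, 545, 344, 143, 353, 255, 234, 435, 333, 543,
      423, 343, 445, 325, 245, 224, 425, 235, 223, 433, 243, 444, 524, 323, 133, 253, 454, 334,
      232, 422, 443, 244, 342, 552]
    (5, 1, 4) (5, 2, 2) (0, 2, 0)
    (1, 1, 5) (3, 1, 6) (0, 2, 0) (by decide +kernel)

/-! ### The boards that have a bi-sited closed tour -/

theorem IsThinExtendable.hasBiSitedClosedTour {n p : ℕ} (h : IsThinExtendable n p) :
    HasBiSitedClosedTour ![2, n, p] := by
  obtain ⟨K, h1, -, -, h4⟩ := h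
  exact (h4.mono Set.subset_union_left).hasBiSitedClosedTour h1

theorem IsExtendable.hasBiSitedClosedTour {m n p : ℕ} (h : IsExtendable m n p) :
    HasBiSitedClosedTour ![m, n, p] := by
  obtain ⟨K, h1, -, -, -, h4⟩ := h
  exact (h4.mono Set.subset_union_left).hasBiSitedClosedTour h1

/-- The `2 × 3 × 6` box is left out, so the reductions below have to avoid it: sides of length `3`
are extended by `4` and not by `3`, `10` is split as `5 + 5`, and the side `6` is halved, since
`2 × 6 × p` with `p ≠ 6` consists of two `2 × 3 × p` boxes. -/
theorem isThinExtendable_of_le {n p : ℕ} (hn : 3 ≤ n) (hnp : n ≤ p) (hp : 4 ≤ p)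
    (h36 : ¬(n = 3 ∧ p = 6)) : IsThinExtendable n p := by
  induction hs : n + p using Nat.strong_induction_on generalizing n p with
  | _ s ih =>
    -- the induction hypothesis, up to the exchange of the two sides
    have ih' : ∀ n' p', 3 ≤ n' → 3 ≤ p' → 4 ≤ max n' p' → ¬(n' = 3 ∧ p' = 6) →
        ¬(n' = 6 ∧ p' = 3) → n' + p' < s → IsThinExtendable n' p' := by
      intro n' p' h1 h2 h3 h4 h5 h6
      rcases le_total n' p' with h | h
      · exact ih _ h6 h1 h (by omega) h4 rfl
      · exact (ih (p' + n') (by omega) h2 h (by omega) (by omega) rfl).symm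
    rcases Nat.lt_or_ge n 4 with h3 | h4
    · obtain rfl : n = 3 := by omega
      rcases Nat.lt_or_ge p 8 with h8 | h8
      · obtain rfl | rfl | rfl : p = 4 ∨ p = 5 ∨ p = 7 := by omega
        · exact isThinExtendable_three_four
        · exact isThinExtendable_three_five
        · exact isThinExtendable_three_seven
      · by_cases h10 : p = 10
        · subst h10
          exact isThinExtendable_three_five.stack (by norm_num) isThinExtendable_three_five
        · have := (ih' 3 (p - 4) (by omega) (by omega) (by omega) (by omega) (by omega)
            (by omega)).stack (by norm_num) isThinExtendable_three_four
          rwa [Nat.sub_add_cancel hp] at this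
    · rcases Nat.lt_or_ge p 6 with h6 | h6
      · obtain ⟨rfl, rfl⟩ | ⟨rfl, rfl⟩ | ⟨rfl, rfl⟩ :
            (n = 4 ∧ p = 4) ∨ (n = 4 ∧ p = 5) ∨ (n = 5 ∧ p = 5) := by omega
        · exact isThinExtendable_four_four
        · exact isThinExtendable_four_five
        · exact isThinExtendable_five_five
      · by_cases hn6 : n = 6
        · subst hn6
          rcases h6.eq_or_lt with rfl | h6
          · exact isThinExtendable_six_six
          · have h := ih' p 3 (by omega) (by omega) (by omega) (by omega) (by omega) (by omega)
            exact (h.stack (by norm_num) h).symm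
        · have := (ih' n (p - 3) (by omega) (by omega) (by omega) (by omega) (by omega)
            (by omega)).stack (by norm_num)
            (ih' n 3 (by omega) (by omega) (by omega) (by omega) (by omega) (by omega))
          rwa [Nat.sub_add_cancel (by omega)] at this

theorem isExtendable_of_even {m n p : ℕ} (hm : 3 ≤ m) (hn : 3 ≤ n) (hp : 3 ≤ p)
    (he : Even m ∨ Even n ∨ Even p) : IsExtendable m n p := by
  induction hs : m + n + p using Nat.strong_induction_on generalizing m n p with
  | _ s ih =>
    simp only [Nat.even_iff] at ih he
    -- a side `p ≥ 6` is shortened by `3` when another side is even, and by `4` otherwise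
    have reduce : ∀ m n p : ℕ, 3 ≤ m → 3 ≤ n → m + n + p = s → m % 2 = 0 ∨ n % 2 = 0 ∨ p % 2 = 0 →
        (7 ≤ p ∨ 6 ≤ p ∧ (m % 2 = 0 ∨ n % 2 = 0)) → IsExtendable m n p := by
      intro m n p hm hn hs he h
      by_cases h2 : m % 2 = 0 ∨ n % 2 = 0
      · have := (ih (m + n + (p - 3)) (by omega) hm hn (by omega) (by omega) rfl).stack
          (by norm_num) (ih (m + n + 3) (by omega) hm hn le_rfl (by omega) rfl)
        rwa [Nat.sub_add_cancel (by omega)] at this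
      · have := (ih (m + n + (p - 4)) (by omega) hm hn (by omega) (by omega) rfl).stack
          (by norm_num) (ih (m + n + 4) (by omega) hm hn (by norm_num) (by omega) rfl)
        rwa [Nat.sub_add_cancel (by omega)] at this
    by_cases hp' : 7 ≤ p ∨ 6 ≤ p ∧ (m % 2 = 0 ∨ n % 2 = 0)
    · exact reduce m n p hm hn hs he hp'
    by_cases hn' : 7 ≤ n ∨ 6 ≤ n ∧ (p % 2 = 0 ∨ m % 2 = 0)
    · exact (reduce p m n hp hm (by omega) (by omega) hn').rotate.rotate
    by_cases hm' : 7 ≤ m ∨ 6 ≤ m ∧ (n % 2 = 0 ∨ p % 2 = 0)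
    · exact (reduce n p m hn hp (by omega) (by omega) hm').rotate
    have base : ∀ m n p : ℕ, IsExtendable m n p → IsExtendable p m n ∧ IsExtendable n p m :=
      fun m n p h => ⟨h.rotate, h.rotate.rotate⟩
    clear reduce ih
    have b1 := isExtendable_three_three_four
    have b2 := isExtendable_three_four_four
    have b3 := isExtendable_three_four_five
    have b4 := isExtendable_four_three_five
    have b5 := isExtendable_four_four_four
    have b6 := isExtendable_four_four_five
    have b7 := isExtendable_four_five_five
    have b8 := isExtendable_three_three_six
    have b9 := isExtendable_three_five_six
    have b10 := isExtendable_five_three_six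
    have b11 := isExtendable_five_five_six
    have hm6 : m ≤ 6 := by omega
    have hn6 : n ≤ 6 := by omega
    have hp6 : p ≤ 6 := by omega
    interval_cases m <;> interval_cases n <;> interval_cases p <;>
      first
      | (exfalso; omega)
      | assumption
      | exact (base _ _ _ (by assumption)).1
      | exact (base _ _ _ (by assumption)).2

theorem theorem4p3 (m n p : ℕ) (hm : 2 ≤ m) (hmn : m ≤ n) (hnp : n ≤ p) :
    HasBiSitedClosedTour ![m, n, p] ↔
      (Even m ∨ Even n ∨ Even p) ∧ 3 ≤ n ∧ 4 ≤ p := by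
  constructor
  · rintro ⟨N, a, ha, -⟩
    have heven := ha.even_card
    simp only [Nat.even_mul] at heven
    have hn : 3 ≤ n := by
      by_contra hn
      obtain rfl : n = 2 := by omega
      obtain rfl : m = 2 := by omega
      exact not_isClosedTour_two_two hnp ha
    refine ⟨by tauto, hn, ?_⟩
    by_contra hp
    obtain rfl : n = 3 := by omega
    obtain rfl : p = 3 := by omega
    obtain rfl | rfl : m = 2 ∨ m = 3 := by omega
    · exact not_isClosedTour_two_three_three ha
    · revert heven
      decide
  · rintro ⟨he, hn, hp⟩
    rcases hm.eq_or_lt with rfl | hm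
    · by_cases h36 : n = 3 ∧ p = 6
      · obtain ⟨rfl, rfl⟩ := h36
        exact hasBiSitedClosedTour_two_three_six
      · exact (isThinExtendable_of_le hn hnp hp h36).hasBiSitedClosedTour
    · exact (isExtendable_of_even hm hn (by omega) he).hasBiSitedClosedTour
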